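/- Theorem 6.4. Let $k$ be any field and let $H=(H,\Delta,\varepsilon,\Phi,\alpha,\beta,S)$ be a quasi-Hopf algebra over $k$: $H$ is a unital associative $k$-algebra, $\Delta:H\to H\otimes H$ and $\varepsilon:H\to k$ are algebra maps, $\Phi\in H\otimes H\otimes H$ is invertible, $\alpha,\beta\in H$, and $S$ is a ($k$-linear) algebra anti-automorphism of $H$, such that for all $h\in H$ $$(\varepsilon\otimes \mathrm{id})\Delta(h)=h=(\mathrm{id}\otimes\varepsilon)\Delta(h),\qquad \Phi\,(\Delta\otimes \mathrm{id})\Delta(h)\,\Phi^{-1}=(\mathrm{id}\otimes\Delta)\Delta(h),$$ $$(\mathrm{id}\otimes \mathrm{id}\otimes\Delta)(\Phi)\,(\Delta\otimes \mathrm{id}\otimes \mathrm{id})(\Phi)=(1\otimes\Phi)\,(\mathrm{id}\otimes\Delta\otimes \mathrm{id})(\Phi)\,(\Phi\otimes 1),\qquad (\mathrm{id}\otimes\varepsilon\otimes \mathrm{id})(\Phi)=1\otimes 1,$$ $$\sum S(h_1)\alpha h_2=\varepsilon(h)\alpha,\qquad \sum h_1\beta S(h_2)=\varepsilon(h)\beta,$$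 $$\sum_i X_i\beta S(Y_i)\alpha Z_i=1,\qquad \sum_i S(\overline X_i)\alpha\overline Y_i\beta S(\overline Z_i)=1,$$ where $\Delta(h)=\sum h_1\otimes h_2$, $\Phi=\sum_i X_i\otimes Y_i\otimes Z_i$ and $\Phi^{-1}=\sum_i\overline X_i\otimes\overline Y_i\otimes\overline Z_i$. For a unit $u$ of $H$ let $H_u$ be the quasi-Hopf algebra $(H,\Delta,\varepsilon,\Phi,u\alpha,\beta u^{-1},S_u)$ with $S_u(h)=uS(h)u^{-1}$. Suppose that $H$ is finite-dimensional and split semisimple, i.e. isomorphic as a $k$-algebra to a finite product of full matrix algebras over $k$. Then there exists a unit $u$ of $H$ such that the antipode $S_u$ of $H_u$ is an involution, that is, $S_u(S_u(h))=h$ for all $h\in H$. -/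

import Mathlib

open scoped TensorProduct
open MulOpposite

universe u v

/-- A quasi-bialgebra structure `(Δ, ε, Φ)` on the `k`-algebra `H`. Threefold and fourfold tensor
powers are bracketed to the right: `H ⊗ (H ⊗ H)` and `H ⊗ (H ⊗ (H ⊗ H))`. -/
structure QuasiBialgebraStructure (k : Type u) (H : Type v) [Field k] [Ring H] [Algebra k H] where
  /-- the diagonal map `Δ` -/
  comul : H →ₐ[k] H ⊗[k] H
  /-- the counit `ε` -/
  counit : H →ₐ[k] k
  /-- the associator `Φ`, an invertible element of `H ⊗ H ⊗ H` -/
  Phi : (H ⊗[k] (H ⊗[k] H))ˣ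
  /-- `(ε ⊗ id) Δ(h) = h` -/
  counit_left : ∀ h : H, Algebra.TensorProduct.lid k H
    (Algebra.TensorProduct.map counit (AlgHom.id k H) (comul h)) = h
  /-- `(id ⊗ ε) Δ(h) = h` -/
  counit_right : ∀ h : H, Algebra.TensorProduct.rid k k H
    (Algebra.TensorProduct.map (AlgHom.id k H) counit (comul h)) = h
  /-- `Φ (Δ ⊗ id)(Δ(h)) Φ⁻¹ = (id ⊗ Δ)(Δ(h))` -/
  quasi_coassoc : ∀ h : H,
    (Phi : H ⊗[k] (H ⊗[k] H)) *
      Algebra.TensorProduct.assoc k k k H H H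
        (Algebra.TensorProduct.map comul (AlgHom.id k H) (comul h)) *
      (↑(Phi⁻¹) : H ⊗[k] (H ⊗[k] H)) =
    Algebra.TensorProduct.map (AlgHom.id k H) comul (comul h)
  /-- `(id ⊗ id ⊗ Δ)(Φ) (Δ ⊗ id ⊗ id)(Φ) = (1 ⊗ Φ) (id ⊗ Δ ⊗ id)(Φ) (Φ ⊗ 1)` -/
  pentagon :
    Algebra.TensorProduct.map (AlgHom.id k H)
        (Algebra.TensorProduct.map (AlgHom.id k H) comul) (Phi : H ⊗[k] (H ⊗[k] H)) *
      Algebra.TensorProduct.assoc k k k H H (H ⊗[k] H)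
        (Algebra.TensorProduct.map comul (AlgHom.id k (H ⊗[k] H))
          (Phi : H ⊗[k] (H ⊗[k] H))) =
    ((1 : H) ⊗ₜ[k] (Phi : H ⊗[k] (H ⊗[k] H))) *
      Algebra.TensorProduct.map (AlgHom.id k H)
        ((Algebra.TensorProduct.assoc k k k H H H).toAlgHom.comp
          (Algebra.TensorProduct.map comul (AlgHom.id k H))) (Phi : H ⊗[k] (H ⊗[k] H)) *
      Algebra.TensorProduct.map (AlgHom.id k H)
        (Algebra.TensorProduct.assoc k k k H H H).toAlgHom
        (Algebra.TensorProduct.assoc k k k H (H ⊗[k] H) H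
          ((Phi : H ⊗[k] (H ⊗[k] H)) ⊗ₜ[k] (1 : H)))
  /-- `(id ⊗ ε ⊗ id)(Φ) = 1 ⊗ 1` -/
  counit_Phi :
    Algebra.TensorProduct.map (AlgHom.id k H)
      ((Algebra.TensorProduct.lid k H).toAlgHom.comp
        (Algebra.TensorProduct.map counit (AlgHom.id k H))) (Phi : H ⊗[k] (H ⊗[k] H)) =
    (1 : H) ⊗ₜ[k] (1 : H)

namespace QuasiHopf

variable {k : Type u} {H : Type v} [Field k] [Ring H] [Algebra k H]

/-- An algebra anti-automorphism `S : H ≃ₐ[k] Hᵐᵒᵖ`, seen as a `k`-linear map `H → H`. -/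
def antiLin (S : H ≃ₐ[k] Hᵐᵒᵖ) : H →ₗ[k] H :=
  (opLinearEquiv k : H ≃ₗ[k] Hᵐᵒᵖ).symm.toLinearMap ∘ₗ S.toLinearMap

@[simp] theorem antiLin_apply (S : H ≃ₐ[k] Hᵐᵒᵖ) (h : H) : antiLin S h = unop (S h) := rfl

/-- The linear map `H ⊗ H → H`, `x ⊗ y ↦ S(x) a y`. -/
noncomputable def leftContract (S : H ≃ₐ[k] Hᵐᵒᵖ) (a : H) : H ⊗[k] H →ₗ[k] H :=
  LinearMap.mul' k H ∘ₗ TensorProduct.map (LinearMap.mulRight k a ∘ₗ antiLin S) LinearMap.id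

/-- The linear map `H ⊗ H → H`, `x ⊗ y ↦ x b S(y)`. -/
noncomputable def rightContract (S : H ≃ₐ[k] Hᵐᵒᵖ) (b : H) : H ⊗[k] H →ₗ[k] H :=
  LinearMap.mul' k H ∘ₗ TensorProduct.map (LinearMap.mulRight k b) (antiLin S)

/-- The linear map `H ⊗ H ⊗ H → H`, `x ⊗ y ⊗ z ↦ x b S(y) a z`. -/
noncomputable def contractOne (S : H ≃ₐ[k] Hᵐᵒᵖ) (a b : H) : H ⊗[k] (H ⊗[k] H) →ₗ[k] H :=
  LinearMap.mul' k H ∘ₗ TensorProduct.map (LinearMap.mulRight k b) (leftContract S a)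

/-- The linear map `H ⊗ H ⊗ H → H`, `x ⊗ y ⊗ z ↦ S(x) a y b S(z)`. -/
noncomputable def contractTwo (S : H ≃ₐ[k] Hᵐᵒᵖ) (a b : H) : H ⊗[k] (H ⊗[k] H) →ₗ[k] H :=
  LinearMap.mul' k H ∘ₗ
    TensorProduct.map (LinearMap.mulRight k a ∘ₗ antiLin S) (rightContract S b)

@[simp] theorem leftContract_tmul (S : H ≃ₐ[k] Hᵐᵒᵖ) (a x y : H) :
    leftContract S a (x ⊗ₜ[k] y) = unop (S x) * a * y := rfl

@[simp] theorem rightContract_tmul (S : H ≃ₐ[k] Hᵐᵒᵖ) (b x y : H) :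
    rightContract S b (x ⊗ₜ[k] y) = x * b * unop (S y) := rfl

@[simp] theorem contractOne_tmul (S : H ≃ₐ[k] Hᵐᵒᵖ) (a b x y z : H) :
    contractOne S a b (x ⊗ₜ[k] (y ⊗ₜ[k] z)) = x * b * (unop (S y) * a * z) := rfl

@[simp] theorem contractTwo_tmul (S : H ≃ₐ[k] Hᵐᵒᵖ) (a b x y z : H) :
    contractTwo S a b (x ⊗ₜ[k] (y ⊗ₜ[k] z)) = unop (S x) * a * (y * b * unop (S z)) := rfl

/-- The anti-automorphism `S_w(h) = w S(h) w⁻¹`. -/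
def conjAnti (S : H ≃ₐ[k] Hᵐᵒᵖ) (w : Hˣ) : H ≃ₐ[k] Hᵐᵒᵖ where
  toFun h := op ((w : H) * unop (S h) * (↑(w⁻¹) : H))
  invFun x := S.symm (op ((↑(w⁻¹) : H) * unop x * (w : H)))
  left_inv h := by simp [mul_assoc]
  right_inv x := by simp [mul_assoc]
  map_mul' x y := by
    rw [← op_mul]
    simp [mul_assoc]
  map_add' x y := by
    rw [← op_add]
    simp [mul_add, add_mul]
  commutes' c := by
    simp only [AlgEquiv.commutes, MulOpposite.algebraMap_apply, unop_op]
    rw [← Algebra.commutes c (w : H), mul_assoc, Units.mul_inv, mul_one]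

@[simp] theorem conjAnti_apply (S : H ≃ₐ[k] Hᵐᵒᵖ) (w : Hˣ) (h : H) :
    conjAnti S w h = op ((w : H) * unop (S h) * (↑(w⁻¹) : H)) := rfl

theorem leftContract_conjAnti (S : H ≃ₐ[k] Hᵐᵒᵖ) (w : Hˣ) (a : H) (t : H ⊗[k] H) :
    leftContract (conjAnti S w) ((w : H) * a) t = (w : H) * leftContract S a t := by
  induction t with
  | zero => simp
  | add s t hs ht => rw [map_add, map_add, hs, ht, mul_add]
  | tmul x y => simp [mul_assoc]

theorem rightContract_conjAnti (S : H ≃ₐ[k] Hᵐᵒᵖ) (w : Hˣ) (b : H) (t : H ⊗[k] H) :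
    rightContract (conjAnti S w) (b * (↑(w⁻¹) : H)) t =
      rightContract S b t * (↑(w⁻¹) : H) := by
  induction t with
  | zero => simp
  | add s t hs ht => rw [map_add, map_add, hs, ht, add_mul]
  | tmul x y => simp [mul_assoc]

theorem contractOne_conjAnti (S : H ≃ₐ[k] Hᵐᵒᵖ) (w : Hˣ) (a b : H)
    (t : H ⊗[k] (H ⊗[k] H)) :
    contractOne (conjAnti S w) ((w : H) * a) (b * (↑(w⁻¹) : H)) t = contractOne S a b t := by
  induction t with
  | zero => simp
  | add s t hs ht => rw [map_add, map_add, hs, ht]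
  | tmul x t =>
    change x * (b * (↑(w⁻¹) : H)) * leftContract (conjAnti S w) ((w : H) * a) t =
      x * b * leftContract S a t
    rw [leftContract_conjAnti]
    simp [mul_assoc]

theorem contractTwo_conjAnti (S : H ≃ₐ[k] Hᵐᵒᵖ) (w : Hˣ) (a b : H)
    (t : H ⊗[k] (H ⊗[k] H)) :
    contractTwo (conjAnti S w) ((w : H) * a) (b * (↑(w⁻¹) : H)) t =
      (w : H) * contractTwo S a b t * (↑(w⁻¹) : H) := by
  induction t with
  | zero => simp
  | add s t hs ht => rw [map_add, map_add, hs, ht, mul_add, add_mul]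
  | tmul x t =>
    change unop (conjAnti S w x) * ((w : H) * a) *
        rightContract (conjAnti S w) (b * (↑(w⁻¹) : H)) t =
      (w : H) * (unop (S x) * a * rightContract S b t) * (↑(w⁻¹) : H)
    rw [rightContract_conjAnti]
    simp [mul_assoc]

end QuasiHopf

/-- A quasi-Hopf algebra structure `(Δ, ε, Φ, α, β, S)` on the `k`-algebra `H`. -/
structure QuasiHopfStructure (k : Type u) (H : Type v) [Field k] [Ring H] [Algebra k H] extends
    QuasiBialgebraStructure k H where
  /-- the element `α` -/
  alpha : H
  /-- the element `β` -/
  beta : H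
  /-- the antipode `S`, as an algebra isomorphism onto the opposite algebra -/
  antipodeOp : H ≃ₐ[k] Hᵐᵒᵖ
  /-- `∑ S(h₁) α h₂ = ε(h) α` -/
  antipode_left : ∀ h : H,
    QuasiHopf.leftContract antipodeOp alpha (comul h) = counit h • alpha
  /-- `∑ h₁ β S(h₂) = ε(h) β` -/
  antipode_right : ∀ h : H,
    QuasiHopf.rightContract antipodeOp beta (comul h) = counit h • beta
  /-- `∑ X β S(Y) α Z = 1` where `Φ = ∑ X ⊗ Y ⊗ Z` -/
  contract_Phi : QuasiHopf.contractOne antipodeOp alpha beta (Phi : H ⊗[k] (H ⊗[k] H)) = 1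
  /-- `∑ S(X') α Y' β S(Z') = 1` where `Φ⁻¹ = ∑ X' ⊗ Y' ⊗ Z'` -/
  contract_Phi_inv :
    QuasiHopf.contractTwo antipodeOp alpha beta (↑(Phi⁻¹) : H ⊗[k] (H ⊗[k] H)) = 1

namespace QuasiHopfStructure

variable {k : Type u} {H : Type v} [Field k] [Ring H] [Algebra k H]

/-- The antipode `S` as a map `H → H`. -/
def antipode (Q : QuasiHopfStructure k H) (h : H) : H := unop (Q.antipodeOp h)

/-- The quasi-Hopf structure `H_w = (Δ, ε, Φ, w α, β w⁻¹, S_w)`, `S_w(h) = w S(h) w⁻¹`,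
for a unit `w` of `H`. -/
def unitTwist (Q : QuasiHopfStructure k H) (w : Hˣ) : QuasiHopfStructure k H where
  toQuasiBialgebraStructure := Q.toQuasiBialgebraStructure
  alpha := (w : H) * Q.alpha
  beta := Q.beta * (↑(w⁻¹) : H)
  antipodeOp := QuasiHopf.conjAnti Q.antipodeOp w
  antipode_left h := by
    rw [QuasiHopf.leftContract_conjAnti, Q.antipode_left, mul_smul_comm]
  antipode_right h := by
    rw [QuasiHopf.rightContract_conjAnti, Q.antipode_right, smul_mul_assoc]
  contract_Phi := by
    rw [QuasiHopf.contractOne_conjAnti, Q.contract_Phi]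
  contract_Phi_inv := by
    rw [QuasiHopf.contractTwo_conjAnti, Q.contract_Phi_inv, mul_one, Units.mul_inv]

theorem unitTwist_antipode (Q : QuasiHopfStructure k H) (w : Hˣ) (h : H) :
    (Q.unitTwist w).antipode h = (w : H) * Q.antipode h * (↑(w⁻¹) : H) := rfl

end QuasiHopfStructure

/-- A `k`-algebra is split semisimple if it is isomorphic to a finite product of full matrix
algebras over `k`. -/
def IsSplitSemisimpleAlgebra (k : Type u) (H : Type v) [Field k] [Ring H] [Algebra k H] : Prop :=
  ∃ (d : ℕ) (n : Fin d → ℕ), (∀ i, n i ≠ 0) ∧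
    Nonempty (H ≃ₐ[k] ((i : Fin d) → Matrix (Fin (n i)) (Fin (n i)) k))

/-! The antipode permutes the matrix blocks of `H`. Once `S²` is known to fix every block,
Skolem–Noether gives `u` block by block (`SplitSemisimple.exists_conj_anti_involutive`). On a block
fixed by `S`, the anti-automorphism is conjugate to transposition. On two blocks exchanged by `S`,
the composite around the pair is inner, and a twist on one of the two blocks undoes it.

The quasi-Hopf axioms serve to show that `S²` fixes each block unit `e`
(`antipode_sq_mul_self_ne_zero`). Call `c` invariant if `∑ S(h₂) c h₁ = ε(h) c`. For invariant `c`,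
put `d = ∑ S(Y' β S(Z')) c X'`, summed over `Φ⁻¹`. Quasi-coassociativity gives `d h = S²(h) d`, and
the pentagon gives `S(α) d = c`. If `c = c e` and `S²(e) e = 0`, then `d e = S²(e) d e = S²(e) e d =
0`, so `c = S(α) d e = 0`. A nonzero invariant `c` in the block of `e` comes from averaging with a
normalized integral; the block trace form shows that it does not vanish. -/

set_option maxSynthPendingDepth 6

/-! ### Contractions of tensors and their product rules. -/

namespace QuasiHopf

variable {k : Type u} {H : Type v} [Field k] [Ring H] [Algebra k H]

/-- The linear map `H ⊗ H → H`, `x ⊗ y ↦ S(y) c x`. -/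
noncomputable def swapContract (S : H ≃ₐ[k] Hᵐᵒᵖ) (c : H) : H ⊗[k] H →ₗ[k] H :=
  leftContract S c ∘ₗ (TensorProduct.comm k H H).toLinearMap

@[simp] theorem swapContract_tmul (S : H ≃ₐ[k] Hᵐᵒᵖ) (c x y : H) :
    swapContract S c (x ⊗ₜ[k] y) = unop (S y) * c * x := rfl

/-- Since `S` reverses products, right factors land outside the contraction of `p`. With `p = Δ(h)`
the inner contraction can then be evaluated by an antipode-type identity. For `rightContract` the
outer factors are the left ones. -/
theorem swapContract_mul_tmul (S : H ≃ₐ[k] Hᵐᵒᵖ) (c x y : H) (p : H ⊗[k] H) :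
    swapContract S c (p * x ⊗ₜ[k] y) = unop (S y) * swapContract S c p * x := by
  induction p with
  | zero => simp
  | add p q hp hq => simp only [add_mul, map_add, hp, hq, mul_add]
  | tmul a b => simp [mul_assoc]

theorem leftContract_mul_tmul (S : H ≃ₐ[k] Hᵐᵒᵖ) (c x y : H) (p : H ⊗[k] H) :
    leftContract S c (p * x ⊗ₜ[k] y) = unop (S x) * leftContract S c p * y := by
  induction p with
  | zero => simp
  | add p q hp hq => simp only [add_mul, map_add, hp, hq, mul_add]
  | tmul a b => simp [mul_assoc]

theorem rightContract_tmul_mul (S : H ≃ₐ[k] Hᵐᵒᵖ) (c x y : H) (p : H ⊗[k] H) :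
    rightContract S c (x ⊗ₜ[k] y * p) = x * rightContract S c p * unop (S y) := by
  induction p with
  | zero => simp
  | add p q hp hq => simp only [add_mul, map_add, hp, hq, mul_add]
  | tmul a b => simp [mul_assoc]

theorem contractOne_tmul' (S : H ≃ₐ[k] Hᵐᵒᵖ) (a b x : H) (t : H ⊗[k] H) :
    contractOne S a b (x ⊗ₜ[k] t) = x * b * leftContract S a t := rfl

theorem contractOne_mul_assoc (S : H ≃ₐ[k] Hᵐᵒᵖ) (a b x y z w : H) (p : H ⊗[k] H) :
    contractOne S a b (x ⊗ₜ[k] (y ⊗ₜ[k] z) * TensorProduct.assoc k H H H (p ⊗ₜ[k] w)) =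
      x * rightContract S b p * unop (S y) * a * z * w := by
  induction p with
  | zero => simp
  | add p q hp hq =>
    simp only [mul_add, map_add, hp, hq, TensorProduct.add_tmul, add_mul]
  | tmul a b => simp [mul_assoc]

/-- The linear map `H ⊗ H ⊗ H → H`, `x ⊗ y ⊗ z ↦ S(y b S(z)) c x`. -/
noncomputable def swapRight (S : H ≃ₐ[k] Hᵐᵒᵖ) (b c : H) : H ⊗[k] (H ⊗[k] H) →ₗ[k] H :=
  swapContract S c ∘ₗ TensorProduct.map LinearMap.id (rightContract S b)

@[simp] theorem swapRight_tmul (S : H ≃ₐ[k] Hᵐᵒᵖ) (b c x : H) (t : H ⊗[k] H) :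
    swapRight S b c (x ⊗ₜ[k] t) = unop (S (rightContract S b t)) * c * x := rfl

/-- The linear map `H ⊗ H ⊗ H ⊗ H → H`, `x ⊗ y ⊗ z ⊗ w ↦ S(y b S(z) a w) c x`. -/
noncomputable def swapOne (S : H ≃ₐ[k] Hᵐᵒᵖ) (a b c : H) :
    H ⊗[k] (H ⊗[k] (H ⊗[k] H)) →ₗ[k] H :=
  swapContract S c ∘ₗ TensorProduct.map LinearMap.id (contractOne S a b)

@[simp] theorem swapOne_tmul (S : H ≃ₐ[k] Hᵐᵒᵖ) (a b c x : H) (t : H ⊗[k] (H ⊗[k] H)) :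
    swapOne S a b c (x ⊗ₜ[k] t) = unop (S (contractOne S a b t)) * c * x := rfl

/-- The factor `w` passes through `S` twice and emerges on the far left; this is where `S²` enters.
-/
theorem swapRight_assoc_mul (S : H ≃ₐ[k] Hᵐᵒᵖ) (b c w x y z : H) (p : H ⊗[k] H) :
    swapRight S b c (TensorProduct.assoc k H H H (p ⊗ₜ[k] w) * x ⊗ₜ[k] (y ⊗ₜ[k] z)) =
      unop (S (unop (S w))) * (unop (S (unop (S z))) * unop (S b) * unop (S y)
        * swapContract S c p * x) := by
  induction p with
  | zero => simp
  | add p q hp hq =>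
    simp only [mul_add, map_add, hp, hq, TensorProduct.add_tmul, add_mul]
  | tmul a b => simp [mul_assoc]

theorem swapOne_assoc_mul (S : H ≃ₐ[k] Hᵐᵒᵖ) (a b c x y : H) (T U : H ⊗[k] H) (p : H ⊗[k] H) :
    swapOne S a b c (TensorProduct.assoc k H H (H ⊗[k] H) (p ⊗ₜ[k] T) *
      x ⊗ₜ[k] (y ⊗ₜ[k] U)) =
      unop (S (y * b * leftContract S a (T * U))) * swapContract S c p * x := by
  induction p with
  | zero => simp
  | add p q hp hq =>
    simp only [mul_add, map_add, hp, hq, TensorProduct.add_tmul, add_mul]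
  | tmul a b => simp [mul_assoc, contractOne_tmul']

end QuasiHopf

/-! ### Collapsing coproducts to counits under a contraction. -/

namespace QuasiHopf

variable {k : Type u} {H : Type v} [Field k] [Ring H] [Algebra k H]

/-- The counit followed by the unit map of a `k`-algebra `A`. -/
noncomputable def unitCounit (ε : H →ₐ[k] k) (A : Type v) [Ring A] [Algebra k A] : H →ₐ[k] A :=
  (Algebra.ofId k A).comp ε

@[simp] theorem unitCounit_apply (ε : H →ₐ[k] k) (A : Type v) [Ring A] [Algebra k A] (h : H) :
    unitCounit ε A h = ε h • (1 : A) := by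
  simp [unitCounit, Algebra.ofId_apply, Algebra.algebraMap_eq_smul_one]

section Collapse

variable (S : H ≃ₐ[k] Hᵐᵒᵖ) (Δ : H →ₐ[k] H ⊗[k] H) (ε : H →ₐ[k] k) (a b c : H)

/-- In this and the next two lemmas, one coproduct factor of the pentagon becomes adjacent to `c`,
`a` or `b` and contracts to a counit. `unitCounit` takes values in `H ⊗ H` so that it can replace
`Δ` without changing the number of legs. The side on which `q` stands is forced by the product
rules. -/
theorem swapOne_comul_first (hΔ : ∀ h, swapContract S c (Δ h) = ε h • c)
    (t : H ⊗[k] (H ⊗[k] H)) (q : H ⊗[k] (H ⊗[k] (H ⊗[k] H))) :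
    swapOne S a b c (TensorProduct.assoc k H H (H ⊗[k] H)
      (Algebra.TensorProduct.map Δ (AlgHom.id k (H ⊗[k] H)) t) * q) =
    swapOne S a b c (TensorProduct.assoc k H H (H ⊗[k] H)
      (Algebra.TensorProduct.map (unitCounit ε (H ⊗[k] H)) (AlgHom.id k (H ⊗[k] H)) t) * q) := by
  induction t with
  | zero => simp
  | add t u ht hu => simp only [map_add, add_mul, ht, hu]
  | tmul h T =>
    induction q with
    | zero => simp
    | add q r hq hr => simp only [map_add, mul_add, hq, hr]
    | tmul x V =>
      induction V with
      | zero => simp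
      | add q r hq hr => simp only [map_add, mul_add, TensorProduct.tmul_add, hq, hr]
      | tmul y U =>
        rw [Algebra.TensorProduct.map_tmul, Algebra.TensorProduct.map_tmul, AlgHom.id_apply,
          swapOne_assoc_mul, swapOne_assoc_mul, hΔ]
        simp [Algebra.TensorProduct.one_def]

theorem swapOne_comul_last (hΔ : ∀ h, leftContract S a (Δ h) = ε h • a)
    (t : H ⊗[k] (H ⊗[k] H)) (q : H ⊗[k] (H ⊗[k] (H ⊗[k] H))) :
    swapOne S a b c (Algebra.TensorProduct.map (AlgHom.id k H)
      (Algebra.TensorProduct.map (AlgHom.id k H) Δ) t * q) =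
    swapOne S a b c (Algebra.TensorProduct.map (AlgHom.id k H)
      (Algebra.TensorProduct.map (AlgHom.id k H) (unitCounit ε (H ⊗[k] H))) t * q) := by
  have key : ∀ h (U : H ⊗[k] H),
      leftContract S a (Δ h * U) = leftContract S a ((ε h • (1 : H ⊗[k] H)) * U) := by
    intro h U
    induction U with
    | zero => simp
    | add q r hq hr => simp only [map_add, mul_add, hq, hr]
    | tmul x y => rw [leftContract_mul_tmul, hΔ]; simp
  induction t with
  | zero => simp
  | add t u ht hu => simp only [map_add, add_mul, ht, hu]
  | tmul f T =>
  induction T with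
  | zero => simp
  | add t u ht hu => simp only [map_add, add_mul, TensorProduct.tmul_add, ht, hu]
  | tmul g h =>
    induction q with
    | zero => simp
    | add q r hq hr => simp only [map_add, mul_add, hq, hr]
    | tmul x V =>
      induction V with
      | zero => simp
      | add q r hq hr => simp only [map_add, mul_add, TensorProduct.tmul_add, hq, hr]
      | tmul y U =>
        simp only [Algebra.TensorProduct.map_tmul, AlgHom.id_apply, unitCounit_apply,
          Algebra.TensorProduct.tmul_mul_tmul, swapOne_tmul, contractOne_tmul', key]

theorem swapOne_comul_middle (hΔ : ∀ h, rightContract S b (Δ h) = ε h • b)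
    (t : H ⊗[k] (H ⊗[k] H)) (q : H ⊗[k] (H ⊗[k] (H ⊗[k] H))) :
    swapOne S a b c (q * Algebra.TensorProduct.map (AlgHom.id k H)
        ((Algebra.TensorProduct.assoc k k k H H H).toAlgHom.comp
          (Algebra.TensorProduct.map Δ (AlgHom.id k H))) t) =
    swapOne S a b c (q * Algebra.TensorProduct.map (AlgHom.id k H)
        ((Algebra.TensorProduct.assoc k k k H H H).toAlgHom.comp
          (Algebra.TensorProduct.map (unitCounit ε (H ⊗[k] H)) (AlgHom.id k H))) t) := by
  induction t with
  | zero => simp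
  | add t u ht hu => simp only [map_add, mul_add, ht, hu]
  | tmul f T =>
  induction T with
  | zero => simp
  | add t u ht hu => simp only [map_add, mul_add, TensorProduct.tmul_add, ht, hu]
  | tmul g h =>
    induction q with
    | zero => simp
    | add q r hq hr => simp only [map_add, add_mul, hq, hr]
    | tmul x V =>
      induction V with
      | zero => simp
      | add q r hq hr => simp only [map_add, add_mul, TensorProduct.tmul_add, hq, hr]
      | tmul y U =>
        induction U with
        | zero => simp
        | add q r hq hr => simp only [map_add, add_mul, TensorProduct.tmul_add, hq, hr]
        | tmul z w =>
          have key : ∀ p : H ⊗[k] H, swapOne S a b c (x ⊗ₜ[k] (y ⊗ₜ[k] (z ⊗ₜ[k] w)) *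
              f ⊗ₜ[k] (TensorProduct.assoc k H H H (p ⊗ₜ[k] h))) =
              unop (S (y * rightContract S b p * unop (S z) * a * w * h)) * c * (x * f) := by
            intro p
            rw [Algebra.TensorProduct.tmul_mul_tmul, swapOne_tmul, contractOne_mul_assoc]
          refine (key (Δ g)).trans (Eq.trans ?_ (key (unitCounit ε (H ⊗[k] H) g)).symm)
          rw [hΔ]
          simp [Algebra.TensorProduct.one_def]

/-- The element `S²(Z) S(b) S(Y) c X` intertwines `S²` with the identity. -/
theorem swapRight_intertwines (hc : ∀ h, swapContract S c (Δ h) = ε h • c)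
    (hb : ∀ h, rightContract S b (Δ h) = ε h • b)
    (hl : ∀ h : H, Algebra.TensorProduct.lid k H
      (Algebra.TensorProduct.map ε (AlgHom.id k H) (Δ h)) = h)
    (hr : ∀ h : H, Algebra.TensorProduct.rid k k H
      (Algebra.TensorProduct.map (AlgHom.id k H) ε (Δ h)) = h)
    (q : H ⊗[k] (H ⊗[k] H))
    (hq : ∀ h, TensorProduct.assoc k H H H
        (Algebra.TensorProduct.map Δ (AlgHom.id k H) (Δ h)) * q =
      q * Algebra.TensorProduct.map (AlgHom.id k H) Δ (Δ h)) (h : H) :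
    swapRight S b c q * h = unop (S (unop (S h))) * swapRight S b c q := by
  -- On the left, the first two legs collapse around `c` and the third survives as `S²`. This holds
  -- for every `q`, so `hq` is dropped before the induction on it.
  have left : ∀ t : H ⊗[k] H, swapRight S b c (TensorProduct.assoc k H H H
        (Algebra.TensorProduct.map Δ (AlgHom.id k H) t) * q) =
      unop (S (unop (S (Algebra.TensorProduct.lid k H
        (Algebra.TensorProduct.map ε (AlgHom.id k H) t))))) * swapRight S b c q := by
    intro t
    induction t with
    | zero => simp
    | add t u ht hu => simp only [map_add, add_mul, ht, hu, unop_add]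
    | tmul f g =>
      clear hq
      induction q with
      | zero => simp
      | add q r hq hr => simp only [map_add, mul_add, hq, hr]
      | tmul x V =>
        induction V with
        | zero => simp
        | add q r hq hr => simp only [map_add, mul_add, TensorProduct.tmul_add, hq, hr]
        | tmul y z =>
          rw [Algebra.TensorProduct.map_tmul, swapRight_assoc_mul, hc]
          simp [mul_assoc]
  -- On the right, the last two legs collapse around `b` and the first survives unchanged.
  have right : ∀ t : H ⊗[k] H, swapRight S b c (q *
        Algebra.TensorProduct.map (AlgHom.id k H) Δ t) =
      swapRight S b c q * Algebra.TensorProduct.rid k k H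
        (Algebra.TensorProduct.map (AlgHom.id k H) ε t) := by
    intro t
    induction t with
    | zero => simp
    | add t u ht hu => simp only [map_add, mul_add, ht, hu]
    | tmul f g =>
      clear hq left
      induction q with
      | zero => simp
      | add q r hq hr => simp only [map_add, add_mul, hq, hr]
      | tmul x V =>
        induction V with
        | zero => simp
        | add q r hq hr => simp only [map_add, add_mul, TensorProduct.tmul_add, hq, hr]
        | tmul y z =>
          rw [Algebra.TensorProduct.map_tmul, Algebra.TensorProduct.tmul_mul_tmul,
            swapRight_tmul, rightContract_tmul_mul, hb]
          simp [mul_assoc]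
  have e := congrArg (swapRight S b c) (hq h)
  rw [left, right, hl, hr] at e
  exact e.symm

end Collapse

end QuasiHopf

/-! ### Counit normalizations of the associator. -/

namespace QuasiHopf

variable {k : Type u} {H : Type v} [Field k] [Ring H] [Algebra k H]

/-- The algebra map `x ⊗ y ↦ ε(x) y`. -/
noncomputable def counitFst (ε : H →ₐ[k] k) (A : Type v) [Ring A] [Algebra k A] :
    H ⊗[k] A →ₐ[k] A :=
  (Algebra.TensorProduct.lid k A).toAlgHom.comp (Algebra.TensorProduct.map ε (AlgHom.id k A))

@[simp] theorem counitFst_tmul (ε : H →ₐ[k] k) (A : Type v) [Ring A] [Algebra k A] (x : H)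
    (y : A) : counitFst ε A (x ⊗ₜ[k] y) = ε x • y := by
  simp [counitFst]

/-- The algebra map `x ⊗ y ↦ ε(y) x`. -/
noncomputable def counitSnd (ε : H →ₐ[k] k) (A : Type v) [Ring A] [Algebra k A] :
    A ⊗[k] H →ₐ[k] A :=
  (Algebra.TensorProduct.rid k k A).toAlgHom.comp (Algebra.TensorProduct.map (AlgHom.id k A) ε)

@[simp] theorem counitSnd_tmul (ε : H →ₐ[k] k) (A : Type v) [Ring A] [Algebra k A] (x : A)
    (y : H) : counitSnd ε A (x ⊗ₜ[k] y) = ε y • x := by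
  simp [counitSnd]

theorem counitFst_assoc (ε : H →ₐ[k] k) (A B : Type v) [Ring A] [Algebra k A] [Ring B]
    [Algebra k B] (p : H ⊗[k] A) (b : B) :
    counitFst ε (A ⊗[k] B) (Algebra.TensorProduct.assoc k k k H A B (p ⊗ₜ[k] b)) =
      counitFst ε A p ⊗ₜ[k] b := by
  induction p with
  | zero => simp
  | add p q hp hq => simp only [TensorProduct.add_tmul, map_add, hp, hq]
  | tmul x y => simp [TensorProduct.smul_tmul']

theorem map_counitFst_assoc (ε : H →ₐ[k] k) (A B : Type v) [Ring A] [Algebra k A] [Ring B]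
    [Algebra k B] (p : A ⊗[k] H) (b : B) :
    Algebra.TensorProduct.map (AlgHom.id k A) (counitFst ε B)
      (Algebra.TensorProduct.assoc k k k A H B (p ⊗ₜ[k] b)) = counitSnd ε A p ⊗ₜ[k] b := by
  induction p with
  | zero => simp
  | add p q hp hq => simp only [TensorProduct.add_tmul, map_add, hp, hq]
  | tmul x y => simp [TensorProduct.smul_tmul']

end QuasiHopf

namespace QuasiBialgebraStructure

open QuasiHopf

variable {k : Type u} {H : Type v} [Field k] [Ring H] [Algebra k H]
variable (Q : QuasiBialgebraStructure k H)

theorem counitFst_comul (h : H) : counitFst Q.counit H (Q.comul h) = h := Q.counit_left h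

theorem counitSnd_comul (h : H) : counitSnd Q.counit H (Q.comul h) = h := Q.counit_right h

theorem map_counitFst_Phi : Algebra.TensorProduct.map (AlgHom.id k H) (counitFst Q.counit H)
    (Q.Phi : H ⊗[k] (H ⊗[k] H)) = 1 := Q.counit_Phi

/-- `(ε ⊗ id ⊗ id)(Φ) = 1` -/
theorem counitFst_Phi :
    counitFst Q.counit (H ⊗[k] H) (Q.Phi : H ⊗[k] (H ⊗[k] H)) = 1 := by
  -- Applying `ε` to the second leg of the pentagon leaves `Φ = (1 ⊗ (ε ⊗ id ⊗ id)(Φ)) Φ`, from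
  -- which `Φ` cancels.
  set K : H ⊗[k] (H ⊗[k] (H ⊗[k] H)) →ₐ[k] H ⊗[k] (H ⊗[k] H) :=
    Algebra.TensorProduct.map (AlgHom.id k H) (counitFst Q.counit (H ⊗[k] H)) with hK
  have hA : ∀ t : H ⊗[k] (H ⊗[k] H), K (Algebra.TensorProduct.map (AlgHom.id k H)
      (Algebra.TensorProduct.map (AlgHom.id k H) Q.comul) t) =
      Algebra.TensorProduct.map (AlgHom.id k H) Q.comul
        (Algebra.TensorProduct.map (AlgHom.id k H) (counitFst Q.counit H) t) := by
    intro t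
    induction t with
    | zero => simp
    | add t u ht hu => simp only [map_add, ht, hu]
    | tmul f T =>
    induction T with
    | zero => simp
    | add t u ht hu => simp only [map_add, TensorProduct.tmul_add, ht, hu]
    | tmul g h => simp [hK]
  have hC : ∀ t : H ⊗[k] (H ⊗[k] H), K (Algebra.TensorProduct.assoc k k k H H (H ⊗[k] H)
        (Algebra.TensorProduct.map Q.comul (AlgHom.id k (H ⊗[k] H)) t)) = t := by
    intro t
    induction t with
    | zero => simp
    | add t u ht hu => simp only [map_add, ht, hu]
    | tmul f T =>
      rw [Algebra.TensorProduct.map_tmul, hK, map_counitFst_assoc, Q.counitSnd_comul]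
      rfl
  have hB : ∀ t : H ⊗[k] (H ⊗[k] H), K (Algebra.TensorProduct.map (AlgHom.id k H)
        ((Algebra.TensorProduct.assoc k k k H H H).toAlgHom.comp
          (Algebra.TensorProduct.map Q.comul (AlgHom.id k H))) t) = t := by
    intro t
    induction t with
    | zero => simp
    | add t u ht hu => simp only [map_add, ht, hu]
    | tmul f T =>
    induction T with
    | zero => simp
    | add t u ht hu => simp only [map_add, TensorProduct.tmul_add, ht, hu]
    | tmul g h =>
      refine congrArg (fun z => f ⊗ₜ[k] z)
        ((counitFst_assoc Q.counit H H (Q.comul g) h).trans ?_)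
      rw [Q.counitFst_comul]
  have hF : ∀ t : H ⊗[k] (H ⊗[k] H), K (Algebra.TensorProduct.map (AlgHom.id k H)
        (Algebra.TensorProduct.assoc k k k H H H).toAlgHom
        (Algebra.TensorProduct.assoc k k k H (H ⊗[k] H) H (t ⊗ₜ[k] (1 : H)))) =
      Algebra.TensorProduct.map (AlgHom.id k H) Algebra.TensorProduct.includeLeft
        (Algebra.TensorProduct.map (AlgHom.id k H) (counitFst Q.counit H) t) := by
    intro t
    induction t with
    | zero => simp
    | add t u ht hu => simp only [map_add, TensorProduct.add_tmul, ht, hu]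
    | tmul f T =>
    induction T with
    | zero => simp
    | add t u ht hu =>
      simp only [map_add, TensorProduct.add_tmul, TensorProduct.tmul_add, ht, hu]
    | tmul g h => simp [hK]
  have e := congrArg K Q.pentagon
  rw [map_mul, map_mul, map_mul, hA, hC, hB, hF, Q.map_counitFst_Phi, map_one, map_one, one_mul,
    mul_one] at e
  have e' : K (1 ⊗ₜ[k] (Q.Phi : H ⊗[k] (H ⊗[k] H))) = 1 :=
    Q.Phi.isUnit.mul_right_cancel (by rw [← e, one_mul])
  have e'' := congrArg (counitFst Q.counit (H ⊗[k] H)) e'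
  rwa [hK, Algebra.TensorProduct.map_tmul, counitFst_tmul, AlgHom.id_apply, map_one, one_smul,
    map_one] at e''

/-- `(id ⊗ id ⊗ ε)(Φ) = 1` -/
theorem map_counitSnd_Phi : Algebra.TensorProduct.map (AlgHom.id k H) (counitSnd Q.counit H)
    (Q.Phi : H ⊗[k] (H ⊗[k] H)) = 1 := by
  -- Now `ε` is applied to the third leg; what remains is `Φ = Φ ((id ⊗ id ⊗ ε)(Φ) ⊗ 1)`.
  set K : H ⊗[k] (H ⊗[k] (H ⊗[k] H)) →ₐ[k] H ⊗[k] (H ⊗[k] H) :=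
    Algebra.TensorProduct.map (AlgHom.id k H)
      (Algebra.TensorProduct.map (AlgHom.id k H) (counitFst Q.counit H)) with hK
  have hA : ∀ t : H ⊗[k] (H ⊗[k] H), K (Algebra.TensorProduct.map (AlgHom.id k H)
      (Algebra.TensorProduct.map (AlgHom.id k H) Q.comul) t) = t := by
    intro t
    induction t with
    | zero => simp
    | add t u ht hu => simp only [map_add, ht, hu]
    | tmul f T =>
    induction T with
    | zero => simp
    | add t u ht hu => simp only [map_add, TensorProduct.tmul_add, ht, hu]
    | tmul g h => simp [hK, Q.counitFst_comul]
  have hC : ∀ t : H ⊗[k] (H ⊗[k] H), K (Algebra.TensorProduct.assoc k k k H H (H ⊗[k] H)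
        (Algebra.TensorProduct.map Q.comul (AlgHom.id k (H ⊗[k] H)) t)) =
      Algebra.TensorProduct.assoc k k k H H H (Algebra.TensorProduct.map Q.comul (AlgHom.id k H)
        (Algebra.TensorProduct.map (AlgHom.id k H) (counitFst Q.counit H) t)) := by
    intro t
    induction t with
    | zero => simp
    | add t u ht hu => simp only [map_add, ht, hu]
    | tmul f T =>
      simp only [Algebra.TensorProduct.map_tmul, AlgHom.id_apply]
      generalize Q.comul f = p
      induction p with
      | zero => simp
      | add p q hp hq => simp only [TensorProduct.add_tmul, map_add, hp, hq]
      | tmul x y => simp [hK]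
  have hB : ∀ t : H ⊗[k] (H ⊗[k] H), K (Algebra.TensorProduct.map (AlgHom.id k H)
        ((Algebra.TensorProduct.assoc k k k H H H).toAlgHom.comp
          (Algebra.TensorProduct.map Q.comul (AlgHom.id k H))) t) = t := by
    intro t
    induction t with
    | zero => simp
    | add t u ht hu => simp only [map_add, ht, hu]
    | tmul f T =>
    induction T with
    | zero => simp
    | add t u ht hu => simp only [map_add, TensorProduct.tmul_add, ht, hu]
    | tmul g h =>
      refine congrArg (fun z => f ⊗ₜ[k] z)
        ((map_counitFst_assoc Q.counit H H (Q.comul g) h).trans ?_)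
      rw [Q.counitSnd_comul]
  have hF : ∀ t : H ⊗[k] (H ⊗[k] H), K (Algebra.TensorProduct.map (AlgHom.id k H)
        (Algebra.TensorProduct.assoc k k k H H H).toAlgHom
        (Algebra.TensorProduct.assoc k k k H (H ⊗[k] H) H (t ⊗ₜ[k] (1 : H)))) =
      Algebra.TensorProduct.map (AlgHom.id k H) Algebra.TensorProduct.includeLeft
        (Algebra.TensorProduct.map (AlgHom.id k H) (counitSnd Q.counit H) t) := by
    intro t
    induction t with
    | zero => simp
    | add t u ht hu => simp only [map_add, TensorProduct.add_tmul, ht, hu]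
    | tmul f T =>
    induction T with
    | zero => simp
    | add t u ht hu =>
      simp only [map_add, TensorProduct.add_tmul, TensorProduct.tmul_add, ht, hu]
    | tmul g h => simp [hK]
  have hP : K (1 ⊗ₜ[k] (Q.Phi : H ⊗[k] (H ⊗[k] H))) = 1 := by
    rw [hK, Algebra.TensorProduct.map_tmul, Q.map_counitFst_Phi]
    rfl
  have e := congrArg K Q.pentagon
  rw [map_mul, map_mul, map_mul, hA, hC, hB, hF, hP, Q.map_counitFst_Phi, map_one, map_one,
    one_mul, mul_one] at e
  have e' := Q.Phi.isUnit.mul_left_cancel ((mul_one _).trans e)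
  have inv : ∀ t : H ⊗[k] H, Algebra.TensorProduct.map (AlgHom.id k H) (counitSnd Q.counit H)
      (Algebra.TensorProduct.map (AlgHom.id k H) Algebra.TensorProduct.includeLeft t) = t := by
    intro t
    induction t with
    | zero => simp
    | add t u ht hu => simp only [map_add, ht, hu]
    | tmul f g => simp
  rw [← inv (Algebra.TensorProduct.map (AlgHom.id k H) (counitSnd Q.counit H) _), ← e', map_one]

/-- Together with the next two lemmas, this shows that the pentagon factors become trivial after
their coproducts have collapsed, one for each leg of `Φ`. -/
theorem assoc_map_unitCounit_Phi : TensorProduct.assoc k H H (H ⊗[k] H)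
    (Algebra.TensorProduct.map (unitCounit Q.counit (H ⊗[k] H)) (AlgHom.id k (H ⊗[k] H))
      (Q.Phi : H ⊗[k] (H ⊗[k] H))) = 1 := by
  have key : ∀ t : H ⊗[k] (H ⊗[k] H), TensorProduct.assoc k H H (H ⊗[k] H)
      (Algebra.TensorProduct.map (unitCounit Q.counit (H ⊗[k] H)) (AlgHom.id k (H ⊗[k] H)) t) =
      1 ⊗ₜ[k] (1 ⊗ₜ[k] counitFst Q.counit (H ⊗[k] H) t) := by
    intro t
    induction t with
    | zero => simp
    | add t u ht hu => simp only [map_add, TensorProduct.tmul_add, ht, hu]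
    | tmul f T => simp [Algebra.TensorProduct.one_def, ← TensorProduct.smul_tmul']
  rw [key, Q.counitFst_Phi]
  rfl

theorem map_assoc_unitCounit_Phi : Algebra.TensorProduct.map (AlgHom.id k H)
    ((Algebra.TensorProduct.assoc k k k H H H).toAlgHom.comp
      (Algebra.TensorProduct.map (unitCounit Q.counit (H ⊗[k] H)) (AlgHom.id k H)))
      (Q.Phi : H ⊗[k] (H ⊗[k] H)) = 1 := by
  have key : ∀ t : H ⊗[k] (H ⊗[k] H), Algebra.TensorProduct.map (AlgHom.id k H)
      ((Algebra.TensorProduct.assoc k k k H H H).toAlgHom.comp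
        (Algebra.TensorProduct.map (unitCounit Q.counit (H ⊗[k] H)) (AlgHom.id k H))) t =
      Algebra.TensorProduct.map (AlgHom.id k H) (Algebra.TensorProduct.includeRight.comp
        Algebra.TensorProduct.includeRight)
        (Algebra.TensorProduct.map (AlgHom.id k H) (counitFst Q.counit H) t) := by
    intro t
    induction t with
    | zero => simp
    | add t u ht hu => simp only [map_add, ht, hu]
    | tmul f T =>
    induction T with
    | zero => simp
    | add t u ht hu => simp only [map_add, TensorProduct.tmul_add, ht, hu]
    | tmul g h => simp [Algebra.TensorProduct.one_def, ← TensorProduct.smul_tmul']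
  rw [key, Q.map_counitFst_Phi, map_one]

theorem map_map_unitCounit_Phi : Algebra.TensorProduct.map (AlgHom.id k H)
    (Algebra.TensorProduct.map (AlgHom.id k H) (unitCounit Q.counit (H ⊗[k] H)))
      (Q.Phi : H ⊗[k] (H ⊗[k] H)) = 1 := by
  have key : ∀ t : H ⊗[k] (H ⊗[k] H), Algebra.TensorProduct.map (AlgHom.id k H)
      (Algebra.TensorProduct.map (AlgHom.id k H) (unitCounit Q.counit (H ⊗[k] H))) t =
      Algebra.TensorProduct.map (AlgHom.id k H) Algebra.TensorProduct.includeLeft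
        (Algebra.TensorProduct.map (AlgHom.id k H) (counitSnd Q.counit H) t) := by
    intro t
    induction t with
    | zero => simp
    | add t u ht hu => simp only [map_add, ht, hu]
    | tmul f T =>
    induction T with
    | zero => simp
    | add t u ht hu => simp only [map_add, TensorProduct.tmul_add, ht, hu]
    | tmul g h => simp [Algebra.TensorProduct.one_def]
  rw [key, Q.map_counitSnd_Phi, map_one]

end QuasiBialgebraStructure

/-! ### Invariant elements and intertwiners from the identity to `S²`. -/

namespace QuasiHopfStructure

open QuasiHopf

variable {k : Type u} {H : Type v} [Field k] [Ring H] [Algebra k H]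
variable (Q : QuasiHopfStructure k H)

/-- An element `c` with `∑ S(h₂) c h₁ = ε(h) c` is recovered from the intertwiner it defines. -/
theorem antipode_alpha_mul_swapRight (c : H)
    (hc : ∀ h, swapContract Q.antipodeOp c (Q.comul h) = Q.counit h • c) :
    unop (Q.antipodeOp Q.alpha) *
      swapRight Q.antipodeOp Q.beta c (↑(Q.Phi⁻¹) : H ⊗[k] (H ⊗[k] H)) = c := by
  set A := Algebra.TensorProduct.map (AlgHom.id k H)
    (Algebra.TensorProduct.map (AlgHom.id k H) Q.comul) with hA
  set F : H ⊗[k] (H ⊗[k] H) →ₐ[k] H ⊗[k] (H ⊗[k] (H ⊗[k] H)) :=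
    ((Algebra.TensorProduct.map (AlgHom.id k H)
        (Algebra.TensorProduct.assoc k k k H H H).toAlgHom).comp
      (Algebra.TensorProduct.assoc k k k H (H ⊗[k] H) H).toAlgHom).comp
        Algebra.TensorProduct.includeLeft with hF
  have hFt : ∀ t, swapOne Q.antipodeOp Q.alpha Q.beta c (F t) =
      unop (Q.antipodeOp Q.alpha) * swapRight Q.antipodeOp Q.beta c t := by
    intro t
    induction t with
    | zero => simp
    | add t u ht hu => simp only [map_add, mul_add, ht, hu]
    | tmul f T =>
    induction T with
    | zero => simp
    | add t u ht hu => simp only [map_add, mul_add, TensorProduct.tmul_add, ht, hu]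
    | tmul g h => simp [hF, mul_assoc]
  have pent := Q.pentagon
  have hP : ∀ (f : H ⊗[k] (H ⊗[k] H) →ₐ[k] H ⊗[k] (H ⊗[k] (H ⊗[k] H))),
      f (↑(Q.Phi⁻¹)) * f Q.Phi = 1 ∧ f Q.Phi * f (↑(Q.Phi⁻¹)) = 1 := fun f => by
    rw [← map_mul, ← map_mul, Units.inv_mul, Units.mul_inv, map_one]; exact ⟨rfl, rfl⟩
  change A Q.Phi * _ = _ * F Q.Phi at pent
  -- The pentagon is rearranged so that each coproduct factor stands on the side where `swapOne`
  -- collapses it. What survives is `1 ⊗ Φ` on one side, giving `c`, and `Φ⁻¹ ⊗ 1` on the other,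
  -- giving `S(α) d`.
  have e : A (↑(Q.Phi⁻¹)) * ((1 ⊗ₜ[k] (Q.Phi : H ⊗[k] (H ⊗[k] H))) *
      Algebra.TensorProduct.map (AlgHom.id k H)
        ((Algebra.TensorProduct.assoc k k k H H H).toAlgHom.comp
          (Algebra.TensorProduct.map Q.comul (AlgHom.id k H))) (Q.Phi : H ⊗[k] (H ⊗[k] H))) =
      TensorProduct.assoc k H H (H ⊗[k] H)
      (Algebra.TensorProduct.map Q.comul (AlgHom.id k (H ⊗[k] H))
        (Q.Phi : H ⊗[k] (H ⊗[k] H))) * F (↑(Q.Phi⁻¹)) := by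
    have := congrArg (fun z => A (↑(Q.Phi⁻¹)) * z * F (↑(Q.Phi⁻¹))) pent
    simp only [mul_assoc, (hP F).2, mul_one] at this
    rw [← mul_assoc (A (↑(Q.Phi⁻¹))) (A Q.Phi), (hP A).1, one_mul] at this
    exact this.symm
  have e2 := congrArg (swapOne Q.antipodeOp Q.alpha Q.beta c) e
  have hinv : Algebra.TensorProduct.map (AlgHom.id k H)
      (Algebra.TensorProduct.map (AlgHom.id k H) (unitCounit Q.counit (H ⊗[k] H)))
      (↑(Q.Phi⁻¹) : H ⊗[k] (H ⊗[k] H)) = 1 := by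
    have := (hP (Algebra.TensorProduct.map (AlgHom.id k H)
      (Algebra.TensorProduct.map (AlgHom.id k H) (unitCounit Q.counit (H ⊗[k] H))))).1
    rwa [Q.map_map_unitCounit_Phi, mul_one] at this
  rw [hA, swapOne_comul_last _ _ _ _ _ _ Q.antipode_left, hinv, one_mul,
    swapOne_comul_middle _ _ _ _ _ _ Q.antipode_right, Q.map_assoc_unitCounit_Phi, mul_one,
    swapOne_comul_first _ _ _ _ _ _ hc, Q.assoc_map_unitCounit_Phi, one_mul, hFt,
    swapOne_tmul, Q.contract_Phi] at e2
  simpa using e2.symm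

/-- A nonzero `c` with `∑ S(h₂) c h₁ = ε(h) c` yields a nonzero intertwiner
between the identity and `S²`. -/
theorem swapRight_antipode_sq (c : H)
    (hc : ∀ h, swapContract Q.antipodeOp c (Q.comul h) = Q.counit h • c) (h : H) :
    swapRight Q.antipodeOp Q.beta c (↑(Q.Phi⁻¹) : H ⊗[k] (H ⊗[k] H)) * h =
    Q.antipode (Q.antipode h) *
      swapRight Q.antipodeOp Q.beta c (↑(Q.Phi⁻¹) : H ⊗[k] (H ⊗[k] H)) := by
  refine swapRight_intertwines _ _ _ _ _ hc Q.antipode_right Q.counit_left Q.counit_right _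
    (fun h => ?_) h
  rw [← Q.quasi_coassoc, mul_assoc, ← mul_assoc _ (Q.Phi : H ⊗[k] (H ⊗[k] H)), ← mul_assoc,
    Units.inv_mul, one_mul]
  rfl

end QuasiHopfStructure

/-! ### Averaging by an integral, and central idempotents under `S²`. -/

namespace QuasiHopf

variable {k : Type u} {H : Type v} [Field k] [Ring H] [Algebra k H]

theorem rightContract_mul_central (S : H ≃ₐ[k] Hᵐᵒᵖ) (b e : H) (he : ∀ h, e * h = h * e)
    (p : H ⊗[k] H) : rightContract S (b * e) p = rightContract S b p * e := by
  induction p with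
  | zero => simp
  | add p q hp hq => simp only [map_add, add_mul, hp, hq]
  | tmul x y => simp only [rightContract_tmul, mul_assoc, he]

theorem contractOne_mul_central (S : H ≃ₐ[k] Hᵐᵒᵖ) (a b e : H) (he : ∀ h, e * h = h * e)
    (p : H ⊗[k] (H ⊗[k] H)) : contractOne S a (b * e) p = contractOne S a b p * e := by
  induction p with
  | zero => simp
  | add p q hp hq => simp only [map_add, add_mul, hp, hq]
  | tmul x T => simp only [contractOne_tmul', mul_assoc, he]

/-- With `p = Δ(L)` and `q = Δ(h)`, this turns `L h = ε(h) L` into the invariance of the averaged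
element. -/
theorem swapContract_swapContract_mul (S : H ≃ₐ[k] Hᵐᵒᵖ) (x e : H) (he : ∀ h, e * h = h * e)
    (p q : H ⊗[k] H) :
    swapContract S (swapContract S x p * e) q = swapContract S x (p * q) * e := by
  induction q with
  | zero => simp
  | add q r hq hr => simp only [map_add, mul_add, add_mul, hq, hr]
  | tmul y z => rw [swapContract_mul_tmul, swapContract_tmul]; simp only [mul_assoc, he]

/-- Cyclicity moves `S(z)` behind `b y`, so the average of `x` is tested by the axiom for `β`. -/
theorem trace_mul_swapContract (S : H ≃ₐ[k] Hᵐᵒᵖ) (t : H →ₗ[k] k)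
    (ht : ∀ a b, t (a * b) = t (b * a)) (b x : H) (p : H ⊗[k] H) :
    t (b * swapContract S x p) = t (rightContract S b p * x) := by
  induction p with
  | zero => simp
  | add p q hp hq => simp only [map_add, mul_add, add_mul, hp, hq]
  | tmul y z =>
    rw [swapContract_tmul, rightContract_tmul, ← mul_assoc, ht]
    simp only [mul_assoc]

end QuasiHopf

namespace QuasiHopfStructure

open QuasiHopf

variable {k : Type u} {H : Type v} [Field k] [Ring H] [Algebra k H]

/-- If `H` has a nondegenerate trace form and a left integral `L` with `ε(L) = 1`, then `S²` does
not move a nonzero central idempotent to an orthogonal one. -/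
theorem antipode_sq_mul_self_ne_zero (Q : QuasiHopfStructure k H) (t : H →ₗ[k] k)
    (ht : ∀ a b, t (a * b) = t (b * a)) (hn : ∀ a, a ≠ 0 → ∃ x, t (a * x) ≠ 0) (L : H)
    (hL : ∀ h, L * h = Q.counit h • L) (hL1 : Q.counit L = 1) (e : H) (he : ∀ h, e * h = h * e)
    (hee : e * e = e) (he0 : e ≠ 0) : Q.antipode (Q.antipode e) * e ≠ 0 := by
  -- Replacing `β` by `β e` in `∑ X β S(Y) α Z = 1` yields `e`.
  have hb : Q.beta * e ≠ 0 := by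
    intro h0
    have := contractOne_mul_central Q.antipodeOp Q.alpha Q.beta e he Q.Phi
    rw [Q.contract_Phi, h0, one_mul] at this
    refine he0 (this.symm.trans ?_)
    simp [contractOne]
  obtain ⟨x, hx⟩ := hn _ hb
  set c := swapContract Q.antipodeOp x (Q.comul L) * e with hc
  have hce : c * e = c := by rw [hc, mul_assoc, hee]
  -- The trace of `β c` is `ε(L) t(β e x) = t(β e x)`, which is nonzero by the choice of `x`.
  have hc0 : c ≠ 0 := by
    intro h0
    apply hx
    have h1 := trace_mul_swapContract Q.antipodeOp t ht (Q.beta * e) x (Q.comul L)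
    rw [rightContract_mul_central _ _ _ he, Q.antipode_right, hL1, one_smul] at h1
    rw [← h1, mul_assoc, he, ← hc, h0, mul_zero, map_zero]
  have hcΔ : ∀ h, swapContract Q.antipodeOp c (Q.comul h) = Q.counit h • c := by
    intro h
    rw [hc, swapContract_swapContract_mul _ _ _ he, ← map_mul, hL, map_smul, map_smul,
      smul_mul_assoc]
  have hd := Q.antipode_alpha_mul_swapRight c hcΔ
  have hdS := Q.swapRight_antipode_sq c hcΔ
  set d := swapRight Q.antipodeOp Q.beta c (↑(Q.Phi⁻¹) : H ⊗[k] (H ⊗[k] H))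
  intro h0
  apply hc0
  have h1 : d * e = 0 := by
    rw [← hee, ← mul_assoc, hdS, mul_assoc, ← he, ← mul_assoc, h0, zero_mul]
  rw [← hce, ← hd, mul_assoc, h1, mul_zero]

end QuasiHopfStructure

/-! ### Automorphisms and anti-automorphisms of matrix algebras. -/

namespace Matrix

variable {k : Type u} [Field k]

/-- Every injective algebra endomorphism of a matrix algebra over a field is inner. -/
theorem exists_conj_of_injective {n : ℕ} (φ : Matrix (Fin n) (Fin n) k →ₐ[k] Matrix (Fin n) (Fin n) k)
    (hφ : Function.Injective φ) :
    ∃ u : (Matrix (Fin n) (Fin n) k)ˣ, ∀ A, φ A = u * A * (↑(u⁻¹) : Matrix (Fin n) (Fin n) k) := by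
  let Φ : Matrix (Fin n) (Fin n) k ≃ₐ[k] Matrix (Fin n) (Fin n) k :=
    AlgEquiv.ofBijective φ ⟨hφ, (LinearMap.injective_iff_surjective (f := φ.toLinearMap)).1 hφ⟩
  let E := Matrix.toLinAlgEquiv' (R := k) (n := Fin n)
  obtain ⟨T, hT⟩ := ((E.symm.trans Φ).trans E).eq_linearEquivConjAlgEquiv
  let U : (Module.End k (Fin n → k))ˣ :=
    ⟨T.toLinearMap, T.symm.toLinearMap, by ext; simp, by ext; simp⟩
  refine ⟨Units.map E.symm.toAlgHom.toMonoidHom U, fun A => E.injective ?_⟩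
  have h1 : E (φ A) = ((E.symm.trans Φ).trans E) (E A) := by
    change E (φ A) = E (φ (E.symm (E A)))
    rw [E.symm_apply_apply]
  rw [h1, hT, map_mul, map_mul, ← map_inv]
  change _ = E (E.symm U.1) * E A * E (E.symm (U⁻¹).1)
  rw [E.apply_symm_apply, E.apply_symm_apply]
  rfl

/-- Every anti-automorphism of a matrix algebra over a field becomes an involution after an
inner twist. -/
theorem exists_conj_anti_involutive {n : ℕ}
    (θ : Matrix (Fin n) (Fin n) k →ₗ[k] Matrix (Fin n) (Fin n) k)
    (h1 : θ 1 = 1) (hm : ∀ A B, θ (A * B) = θ B * θ A) (hθ : Function.Injective θ) :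
    ∃ u : (Matrix (Fin n) (Fin n) k)ˣ, ∀ A,
      (u : Matrix (Fin n) (Fin n) k) * θ (u * θ A * (↑(u⁻¹) : Matrix (Fin n) (Fin n) k)) *
        (↑(u⁻¹) : Matrix (Fin n) (Fin n) k) = A := by
  -- Transposing `θ` gives an algebra endomorphism, hence conjugation by some `v`. Twisting `θ` by
  -- `u = vᵀ` then gives exactly the transpose.
  let φ : Matrix (Fin n) (Fin n) k →ₐ[k] Matrix (Fin n) (Fin n) k :=
    AlgHom.ofLinearMap ((Matrix.transposeLinearEquiv (Fin n) (Fin n) k k).toLinearMap ∘ₗ θ)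
      (by simp [h1]) (by simp [hm])
  have hφ : ∀ A, φ A = (θ A)ᵀ := fun A => rfl
  obtain ⟨v, hv⟩ := exists_conj_of_injective φ
    (fun A B h => hθ (Matrix.transpose_injective h))
  let u : (Matrix (Fin n) (Fin n) k)ˣ :=
    ⟨(v : Matrix (Fin n) (Fin n) k)ᵀ, (↑(v⁻¹) : Matrix (Fin n) (Fin n) k)ᵀ,
      by rw [← transpose_mul, Units.inv_mul, transpose_one],
      by rw [← transpose_mul, Units.mul_inv, transpose_one]⟩
  have hu : ∀ A, (u : Matrix (Fin n) (Fin n) k) * θ A *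
      (↑(u⁻¹) : Matrix (Fin n) (Fin n) k) = Aᵀ := by
    intro A
    have h2 : θ A = (↑(u⁻¹) : Matrix (Fin n) (Fin n) k) * Aᵀ * u := by
      rw [← transpose_transpose (θ A), ← hφ, hv, transpose_mul, transpose_mul, ← mul_assoc]
      rfl
    rw [h2, mul_assoc, mul_assoc, mul_assoc, Units.mul_inv, mul_one, Units.mul_inv_cancel_left]
  exact ⟨u, fun A => by rw [hu, hu, transpose_transpose]⟩

/-- A pair of mutually "almost inverse" anti-isomorphisms between matrix algebras can be twisted
into inverse ones by twisting on one side only. -/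
theorem exists_conj_anti_pair {m n : ℕ}
    (θ : Matrix (Fin m) (Fin m) k →ₗ[k] Matrix (Fin n) (Fin n) k)
    (η : Matrix (Fin n) (Fin n) k →ₗ[k] Matrix (Fin m) (Fin m) k)
    (hθ1 : θ 1 = 1) (hη1 : η 1 = 1) (hθm : ∀ A B, θ (A * B) = θ B * θ A)
    (hηm : ∀ A B, η (A * B) = η B * η A) (hθ : Function.Injective θ)
    (hη : Function.Injective η) :
    ∃ u : (Matrix (Fin n) (Fin n) k)ˣ,
      (∀ A, (u : Matrix (Fin n) (Fin n) k) * θ (η A) *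
        (↑(u⁻¹) : Matrix (Fin n) (Fin n) k) = A) ∧
      ∀ B, η (u * θ B * (↑(u⁻¹) : Matrix (Fin n) (Fin n) k)) = B := by
  let φ : Matrix (Fin n) (Fin n) k →ₐ[k] Matrix (Fin n) (Fin n) k :=
    AlgHom.ofLinearMap (θ ∘ₗ η) (by simp [hθ1, hη1]) (by simp [hθm, hηm])
  have hφ : ∀ A, φ A = θ (η A) := fun A => rfl
  obtain ⟨v, hv⟩ := exists_conj_of_injective φ (hθ.comp hη)
  have key : ∀ A, (↑(v⁻¹) : Matrix (Fin n) (Fin n) k) * θ (η A) * v = A := by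
    intro A
    rw [← hφ, hv, mul_assoc, mul_assoc, mul_assoc, Units.inv_mul, mul_one,
      Units.inv_mul_cancel_left]
  -- The same `v⁻¹` serves the other composite: after applying the injective `θ`, the claim is again
  -- that `θ ∘ η` is conjugation by `v`.
  refine ⟨v⁻¹, fun A => by rw [inv_inv, key], fun B => hθ ?_⟩
  rw [inv_inv, ← hφ, hv, mul_assoc, mul_assoc, mul_assoc, Units.mul_inv, mul_one,
    Units.mul_inv_cancel_left]

/-- A central idempotent matrix over a field is `0` or `1`. -/
theorem eq_zero_or_one_of_central_idempotent {n : ℕ} (A : Matrix (Fin n) (Fin n) k)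
    (hc : ∀ B, A * B = B * A) (hA : A * A = A) : A = 0 ∨ A = 1 := by
  have h : A ∈ Set.center (Matrix (Fin n) (Fin n) k) :=
    Semigroup.mem_center_iff.2 fun B => (hc B).symm
  rw [center_eq_range] at h
  obtain ⟨r, rfl⟩ := h
  rcases isEmpty_or_nonempty (Fin n) with hn | ⟨⟨i⟩⟩
  · exact Or.inl (Subsingleton.elim _ _)
  · have hr : r * r = r := by simpa using congrFun (congrFun hA i) i
    rcases IsIdempotentElem.iff_eq_zero_or_one.1 hr with h | h
    · left; simp [h]
    · right; simp [h]

end Matrix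

/-! ### Blocks of a split semisimple algebra and the choice of the twist. -/

namespace SplitSemisimple

open QuasiHopf

variable {k : Type u} {H : Type v} [Field k] [Ring H] [Algebra k H] {d : ℕ} {n : Fin d → ℕ}
  (f : H ≃ₐ[k] ((i : Fin d) → Matrix (Fin (n i)) (Fin (n i)) k))

/-- The projection of a split semisimple algebra onto its `i`-th matrix block. -/
def blockProj (i : Fin d) : H →ₐ[k] Matrix (Fin (n i)) (Fin (n i)) k :=
  (Pi.evalAlgHom k (fun i => Matrix (Fin (n i)) (Fin (n i)) k) i).comp f.toAlgHom

/-- The inclusion of the `i`-th matrix block into a split semisimple algebra. -/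
def blockIncl (i : Fin d) : Matrix (Fin (n i)) (Fin (n i)) k →ₗ[k] H :=
  f.symm.toLinearMap ∘ₗ LinearMap.single k (fun i => Matrix (Fin (n i)) (Fin (n i)) k) i

/-- The unit of the `i`-th matrix block. -/
def blockOne (i : Fin d) : H := blockIncl f i 1

theorem blockProj_apply (i : Fin d) (h : H) : blockProj f i h = f h i := rfl

theorem blockProj_blockIncl (i : Fin d) (A : Matrix (Fin (n i)) (Fin (n i)) k) :
    blockProj f i (blockIncl f i A) = A := by
  simp [blockProj_apply, blockIncl]

theorem blockProj_blockIncl_of_ne {i j : Fin d} (hij : i ≠ j)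
    (A : Matrix (Fin (n j)) (Fin (n j)) k) : blockProj f i (blockIncl f j A) = 0 := by
  simp [blockProj_apply, blockIncl, hij]

theorem ext_blockProj {h h' : H} (e : ∀ i, blockProj f i h = blockProj f i h') : h = h' :=
  f.injective (funext e)

theorem blockProj_blockOne (i : Fin d) : blockProj f i (blockOne f i) = 1 :=
  blockProj_blockIncl f i 1

theorem blockOne_mul (i : Fin d) (h : H) :
    blockOne f i * h = blockIncl f i (blockProj f i h) := by
  refine ext_blockProj f fun j => ?_
  rw [map_mul (blockProj f j)]
  rcases eq_or_ne j i with rfl | hij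
  · rw [blockProj_blockOne, blockProj_blockIncl, one_mul]
  · rw [blockProj_blockIncl_of_ne f hij, blockOne, blockProj_blockIncl_of_ne f hij, zero_mul]

theorem mul_blockOne (i : Fin d) (h : H) :
    h * blockOne f i = blockIncl f i (blockProj f i h) := by
  refine ext_blockProj f fun j => ?_
  rw [map_mul (blockProj f j)]
  rcases eq_or_ne j i with rfl | hij
  · rw [blockProj_blockOne, blockProj_blockIncl, mul_one]
  · rw [blockProj_blockIncl_of_ne f hij, blockOne, blockProj_blockIncl_of_ne f hij, mul_zero]

theorem blockOne_comm (i : Fin d) (h : H) : blockOne f i * h = h * blockOne f i := by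
  rw [blockOne_mul, mul_blockOne]

theorem blockOne_mul_self (i : Fin d) : blockOne f i * blockOne f i = blockOne f i := by
  rw [blockOne_mul, blockProj_blockOne]; rfl

theorem blockOne_mul_of_ne {i j : Fin d} (hij : i ≠ j) : blockOne f i * blockOne f j = 0 := by
  rw [blockOne_mul, blockOne, blockProj_blockIncl_of_ne f hij, map_zero]

theorem blockIncl_mul (i : Fin d) (A B : Matrix (Fin (n i)) (Fin (n i)) k) :
    blockIncl f i (A * B) = blockIncl f i A * blockIncl f i B := by
  refine ext_blockProj f fun j => ?_
  rw [map_mul (blockProj f j)]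
  rcases eq_or_ne j i with rfl | hij
  · simp only [blockProj_blockIncl]
  · simp only [blockProj_blockIncl_of_ne f hij, zero_mul]

theorem blockIncl_injective (i : Fin d) : Function.Injective (blockIncl f i) :=
  Function.LeftInverse.injective (blockProj_blockIncl f i)

theorem blockOne_ne_zero {i : Fin d} (hn : n i ≠ 0) : blockOne f i ≠ 0 := by
  have : NeZero (n i) := ⟨hn⟩
  intro h
  have := congrArg (blockProj f i) h
  rw [blockProj_blockOne, map_zero] at this
  exact one_ne_zero this

theorem sum_blockOne : ∑ i, blockOne f i = 1 := by
  refine ext_blockProj f fun j => ?_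
  rw [map_sum, Finset.sum_eq_single j, blockProj_blockOne, map_one]
  · exact fun i _ hij => blockProj_blockIncl_of_ne f hij.symm 1
  · simp

theorem exists_mul_blockOne_ne_zero {h : H} (hh : h ≠ 0) : ∃ i, h * blockOne f i ≠ 0 := by
  by_contra! H0
  apply hh
  rw [← mul_one h, ← sum_blockOne f, Finset.mul_sum]
  exact Finset.sum_eq_zero fun i _ => H0 i

theorem mul_blockOne_of_central_idempotent {z : H} (hc : ∀ h, z * h = h * z) (hz : z * z = z)
    (i : Fin d) : z * blockOne f i = 0 ∨ z * blockOne f i = blockOne f i := by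
  rw [mul_blockOne]
  rcases Matrix.eq_zero_or_one_of_central_idempotent (blockProj f i z) (fun B => by
    rw [← blockProj_blockIncl f i B, ← map_mul, hc, map_mul]) (by rw [← map_mul, hz]) with h | h
  · left; rw [h, map_zero]
  · right; rw [h]; rfl

theorem unop_anti_mul (S : H ≃ₐ[k] Hᵐᵒᵖ) (x y : H) :
    unop (S (x * y)) = unop (S y) * unop (S x) := by simp

theorem unop_anti_comm (S : H ≃ₐ[k] Hᵐᵒᵖ) {z : H} (hc : ∀ h, z * h = h * z) (h : H) :
    unop (S z) * h = h * unop (S z) := by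
  obtain ⟨x, hx⟩ := S.surjective (op h)
  have : h = unop (S x) := by rw [hx]; rfl
  rw [this, ← unop_anti_mul, ← unop_anti_mul, hc]

/-- An anti-automorphism permutes the matrix blocks. -/
theorem exists_anti_blockOne (hn : ∀ i, n i ≠ 0) (S : H ≃ₐ[k] Hᵐᵒᵖ) (i : Fin d) :
    ∃ j, unop (S (blockOne f i)) = blockOne f j := by
  have h0 : unop (S (blockOne f i)) ≠ 0 := by
    simpa using blockOne_ne_zero f (hn i)
  obtain ⟨j, hj⟩ := exists_mul_blockOne_ne_zero f h0
  refine ⟨j, ?_⟩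
  have h1 := (mul_blockOne_of_central_idempotent f (unop_anti_comm S (blockOne_comm f i))
    (by rw [← unop_anti_mul, blockOne_mul_self]) j).resolve_left hj
  -- The preimage `z` of the `j`-th block unit is also a central idempotent, and it meets block `i`,
  -- hence contains it. So `S(e_i)` and `e_j` absorb each other and are equal.
  obtain ⟨z, hz⟩ := S.surjective (op (blockOne f j))
  have hz' : unop (S z) = blockOne f j := by rw [hz]; rfl
  have inj : ∀ x y : H, unop (S x) = unop (S y) → x = y := fun x y h =>
    S.injective (unop_injective h)
  have h2 := (mul_blockOne_of_central_idempotent f (z := z)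
    (fun h => inj _ _ (by rw [unop_anti_mul, unop_anti_mul, hz', blockOne_comm]))
    (inj _ _ (by rw [unop_anti_mul, hz', blockOne_mul_self])) i).resolve_left (fun h => hj (by
      rw [← hz', ← unop_anti_mul, h, map_zero, unop_zero]))
  rw [← h1, ← hz', ← unop_anti_mul, h2]

/-- The linear map from the `j`-th to the `i`-th block induced by an anti-automorphism. -/
def blockAnti (S : H ≃ₐ[k] Hᵐᵒᵖ) (i j : Fin d) :
    Matrix (Fin (n j)) (Fin (n j)) k →ₗ[k] Matrix (Fin (n i)) (Fin (n i)) k :=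
  (blockProj f i).toLinearMap ∘ₗ antiLin S ∘ₗ blockIncl f j

theorem blockAnti_apply (S : H ≃ₐ[k] Hᵐᵒᵖ) (i j : Fin d)
    (A : Matrix (Fin (n j)) (Fin (n j)) k) :
    blockAnti f S i j A = blockProj f i (unop (S (blockIncl f j A))) := rfl

section

variable {f} {S : H ≃ₐ[k] Hᵐᵒᵖ} {i j : Fin d}

theorem blockAnti_one (hS : unop (S (blockOne f j)) = blockOne f i) : blockAnti f S i j 1 = 1 := by
  rw [blockAnti_apply, ← blockOne, hS, blockProj_blockOne]

/-- Block `i` of `S(x)` sees only block `j` of `x`, because `S(x e_j) = e_i S(x)`. -/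
theorem blockProj_anti (hS : unop (S (blockOne f j)) = blockOne f i) (x : H) :
    blockProj f i (unop (S x)) = blockAnti f S i j (blockProj f j x) := by
  rw [blockAnti_apply, ← mul_blockOne, unop_anti_mul, hS, map_mul, blockProj_blockOne, one_mul]

theorem blockAnti_injective (hS : unop (S (blockOne f j)) = blockOne f i) :
    Function.Injective (blockAnti f S i j) := by
  refine (injective_iff_map_eq_zero _).2 fun A hA => ?_
  have h1 : unop (S (blockIncl f j A)) = 0 := by
    have : blockIncl f j A * blockOne f j = blockIncl f j A := by
      rw [mul_blockOne, blockProj_blockIncl]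
    rw [← this, unop_anti_mul, hS, blockOne_mul, ← blockAnti_apply, hA, map_zero]
  have h2 : blockIncl f j A = 0 := by simpa using h1
  exact blockIncl_injective f j (by rw [h2, map_zero])

end

theorem blockAnti_mul (S : H ≃ₐ[k] Hᵐᵒᵖ) (i j : Fin d)
    (A B : Matrix (Fin (n j)) (Fin (n j)) k) :
    blockAnti f S i j (A * B) = blockAnti f S i j B * blockAnti f S i j A := by
  rw [blockAnti_apply, blockIncl_mul, unop_anti_mul, map_mul (blockProj f i)]
  rfl

/-- An anti-automorphism of a split semisimple algebra whose square fixes the matrix blocks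
becomes an involution after an inner twist. -/
theorem exists_conj_anti_involutive (hn : ∀ i, n i ≠ 0) (S : H ≃ₐ[k] Hᵐᵒᵖ)
    (hS : ∀ i, unop (S (unop (S (blockOne f i)))) * blockOne f i ≠ 0) :
    ∃ w : Hˣ, ∀ h, (w : H) * unop (S (w * unop (S h) * (↑(w⁻¹) : H))) * (↑(w⁻¹) : H) = h := by
  choose σ hσ using exists_anti_blockOne f hn S
  have hσσ : ∀ i, σ (σ i) = i := by
    intro i
    by_contra hne
    apply hS i
    rw [hσ, hσ, blockOne_mul_of_ne f hne]
  have hσ' : ∀ i, unop (S (blockOne f (σ i))) = blockOne f i := fun i => by rw [hσ, hσσ]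
  -- In an exchanged pair only the block with the larger index is twisted; the other gets `1`. The
  -- partner is a variable `j` with `σ i = j`, so that `σ (σ i)` can be replaced by `i` without
  -- transporting matrices between index types.
  have hu : ∀ i, ∃ u : (Matrix (Fin (n i)) (Fin (n i)) k)ˣ,
      (σ i = i → ∀ A, (u : Matrix (Fin (n i)) (Fin (n i)) k) * blockAnti f S i i
        (u * blockAnti f S i i A * (↑(u⁻¹) : Matrix (Fin (n i)) (Fin (n i)) k)) *
          (↑(u⁻¹) : Matrix (Fin (n i)) (Fin (n i)) k) = A) ∧
      (∀ j, σ i = j → j < i →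
        (∀ A, (u : Matrix (Fin (n i)) (Fin (n i)) k) * blockAnti f S i j (blockAnti f S j i A) *
          (↑(u⁻¹) : Matrix (Fin (n i)) (Fin (n i)) k) = A) ∧
        ∀ B, blockAnti f S j i (u * blockAnti f S i j B *
          (↑(u⁻¹) : Matrix (Fin (n i)) (Fin (n i)) k)) = B) ∧
      (i < σ i → u = 1) := by
    intro i
    rcases lt_trichotomy (σ i) i with h | h | h
    · obtain ⟨u, h1, h2⟩ := Matrix.exists_conj_anti_pair (blockAnti f S i (σ i))
        (blockAnti f S (σ i) i) (blockAnti_one (hσ' i)) (blockAnti_one (hσ i))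
        (blockAnti_mul f S _ _) (blockAnti_mul f S _ _) (blockAnti_injective (hσ' i))
        (blockAnti_injective (hσ i))
      refine ⟨u, fun h' => absurd h' h.ne, ?_, fun h' => absurd h' h.asymm⟩
      rintro j rfl -
      exact ⟨h1, h2⟩
    · have hi : unop (S (blockOne f i)) = blockOne f i := by rw [hσ, h]
      obtain ⟨u, h1⟩ := Matrix.exists_conj_anti_involutive (blockAnti f S i i)
        (blockAnti_one hi) (blockAnti_mul f S _ _) (blockAnti_injective hi)
      exact ⟨u, fun _ => h1, fun j hj hji => absurd (hj.symm.trans h) hji.ne,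
        fun h' => absurd h h'.ne'⟩
    · exact ⟨1, fun h' => absurd h' h.ne', fun j hj hji => absurd (hj ▸ hji) h.asymm,
        fun _ => rfl⟩
  choose u hu1 hu2 hu3 using hu
  let w : Hˣ := Units.map f.symm.toAlgHom.toMonoidHom (MulEquiv.piUnits.symm u)
  have hw : ∀ i, blockProj f i w = u i := fun i =>
    congrFun (f.apply_symm_apply (MulEquiv.piUnits.symm u).1) i
  have hw' : ∀ i, blockProj f i (↑(w⁻¹) : H) =
      (↑((u i)⁻¹) : Matrix (Fin (n i)) (Fin (n i)) k) := fun i =>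
    congrFun (f.apply_symm_apply (MulEquiv.piUnits.symm u)⁻¹.1) i
  refine ⟨w, fun h => ext_blockProj f fun i => ?_⟩
  rcases lt_trichotomy (σ i) i with hi | hi | hi
  · rw [map_mul (blockProj f i), map_mul (blockProj f i), hw, hw', blockProj_anti (hσ' i),
      map_mul (blockProj f (σ i)), map_mul (blockProj f (σ i)), hw, hw',
      blockProj_anti (hσ i), hu3 (σ i) (by rwa [hσσ]), inv_one, Units.val_one, one_mul, mul_one]
    exact (hu2 i _ rfl hi).1 _
  · have hi' : unop (S (blockOne f i)) = blockOne f i := by rw [hσ, hi]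
    rw [map_mul (blockProj f i), map_mul (blockProj f i), hw, hw', blockProj_anti hi',
      map_mul (blockProj f i), map_mul (blockProj f i), hw, hw',
      blockProj_anti hi']
    exact hu1 i hi _
  · rw [map_mul (blockProj f i), map_mul (blockProj f i), hw, hw', blockProj_anti (hσ' i),
      map_mul (blockProj f (σ i)), map_mul (blockProj f (σ i)), hw, hw',
      blockProj_anti (hσ i), hu3 i hi, inv_one, Units.val_one, one_mul, mul_one]
    exact (hu2 (σ i) i (hσσ i) hi).2 _

/-- The sum of the traces of the blocks. -/
def blockTrace : H →ₗ[k] k :=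
  ∑ i, Matrix.traceLinearMap (Fin (n i)) k k ∘ₗ (blockProj f i).toLinearMap

theorem blockTrace_apply (h : H) : blockTrace f h = ∑ i, (blockProj f i h).trace := by
  simp [blockTrace]

theorem blockTrace_mul_comm (a b : H) : blockTrace f (a * b) = blockTrace f (b * a) := by
  simp only [blockTrace_apply, map_mul]
  exact Finset.sum_congr rfl fun i _ => Matrix.trace_mul_comm _ _

theorem blockTrace_mul_blockIncl (a : H) (i : Fin d) (A : Matrix (Fin (n i)) (Fin (n i)) k) :
    blockTrace f (a * blockIncl f i A) = (blockProj f i a * A).trace := by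
  rw [blockTrace_apply, Finset.sum_eq_single i, map_mul, blockProj_blockIncl]
  · intro j _ hj
    rw [map_mul, blockProj_blockIncl_of_ne f hj, mul_zero, Matrix.trace_zero]
  · simp

/-- Testing against elements of one block reduces this to nondegeneracy of the matrix trace pairing.
-/
theorem blockTrace_nondegenerate (a : H) (ha : a ≠ 0) : ∃ x, blockTrace f (a * x) ≠ 0 := by
  by_contra! h0
  refine ha (ext_blockProj f fun i => ?_)
  rw [map_zero]
  refine Matrix.ext_iff_trace_mul_right.2 fun A => ?_
  rw [← blockTrace_mul_blockIncl, h0, zero_mul, Matrix.trace_zero]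

/-- An augmentation of a split semisimple algebra is carried by one block, whose unit is a left
integral. -/
theorem exists_normalized_integral
    (f : H ≃ₐ[k] ((i : Fin d) → Matrix (Fin (n i)) (Fin (n i)) k)) (hn : ∀ i, n i ≠ 0) (ε : H →ₐ[k] k) :
    ∃ L : H, (∀ h, L * h = ε h • L) ∧ ε L = 1 := by
  obtain ⟨i, hi⟩ : ∃ i, ε (blockOne f i) ≠ 0 := by
    by_contra! h0
    have := congrArg ε (sum_blockOne f)
    rw [map_sum, map_one, Finset.sum_eq_zero fun i _ => h0 i] at this
    exact zero_ne_one this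
  have hi1 : ε (blockOne f i) = 1 := by
    have := congrArg ε (blockOne_mul_self f i)
    rw [map_mul] at this
    exact mul_right_cancel₀ hi (by rw [this, one_mul])
  have : NeZero (n i) := ⟨hn i⟩
  let φ : Matrix (Fin (n i)) (Fin (n i)) k →ₐ[k] k :=
    AlgHom.ofLinearMap (ε.toLinearMap ∘ₗ blockIncl f i) hi1
      (fun A B => by simp [blockIncl_mul])
  -- A nonzero matrix algebra is simple, so the block on which `ε` is nonzero embeds in `k`; there,
  -- `h` acts as the scalar `ε(h)`.
  have hφ : Function.Injective φ := φ.toRingHom.injective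
  refine ⟨blockOne f i, fun h => ?_, hi1⟩
  rw [blockOne_mul, blockOne, ← map_smul]
  congr 1
  apply hφ
  have h1 : φ (blockProj f i h) = ε h := by
    change ε (blockIncl f i (blockProj f i h)) = _
    rw [← mul_blockOne, map_mul, hi1, mul_one]
  rw [h1, map_smul, map_one, smul_eq_mul, mul_one]

end SplitSemisimple

theorem theorem6p4 (k : Type u) (H : Type v) [Field k] [Ring H] [Algebra k H]
    [FiniteDimensional k H] (hH : IsSplitSemisimpleAlgebra k H) (Q : QuasiHopfStructure k H) :
    ∃ w : Hˣ, Function.Involutive (Q.unitTwist w).antipode := by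
  obtain ⟨d, n, hn, ⟨f⟩⟩ := hH
  obtain ⟨L, hL, hL1⟩ := SplitSemisimple.exists_normalized_integral f hn Q.counit
  exact SplitSemisimple.exists_conj_anti_involutive f hn Q.antipodeOp fun i =>
    Q.antipode_sq_mul_self_ne_zero (SplitSemisimple.blockTrace f)
      (SplitSemisimple.blockTrace_mul_comm f) (SplitSemisimple.blockTrace_nondegenerate f) L hL
      hL1 _ (SplitSemisimple.blockOne_comm f i) (SplitSemisimple.blockOne_mul_self f i)
      (SplitSemisimple.blockOne_ne_zero f (hn i))
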